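/- Let $k$ be a field that is complete with respect to a non-Archimedean absolute value $|\cdot|$ (possibly trivial), let $n\ge 0$, and let $\mathbf r=(r_1,\dots,r_n)$ and $\mathbf s=(s_1,\dots,s_n)$ be families of positive real numbers. Let $\mathbb D_{\mathbf r}$ denote the closed $k$-polydisc centred at the origin of polyradius $\mathbf r$, that is, the domain of the Berkovich analytic affine space $\mathbb A^{n,\mathrm{an}}_k$ defined by $|T_i|\le r_i$ for all $i$; equivalently, the $k$-affinoid space of the Banach algebra $k\{r_1^{-1}T_1,\dots,r_n^{-1}T_n\}$ of power series $\sum_I a_I T^I$ with $|a_I|\,\mathbf r^I\to 0$, with the norm $\sup_I |a_I|\,\mathbf r^I$. A $k$-analytic space is called a closed $k$-polydisc of type $\mathbf r$ if it is isomorphic to $\mathbb D_{\mathbf r}$ (as a $k$-analytic space in the sense of Berkovich; for $k$-affinoid spaces, isomorphisms correspond to isomorphisms of $k$-algebras between the affinoid algebras that are bounded together with their inverses). Let $X$ be a closed $k$-polydisc of type $\mathbf r$ and $Y$ a closed $k$-polydisc of type $\mathbf s$. Then $X$ and $Y$ are isomorphic if and only if there is a permutation $\sigma$ of $\{1,\dots,n\}$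 such that $s_{\sigma(i)}\,r_i^{-1}\in |k^\times|$ for every $i\in\{1,\dots,n\}$. -/

import Mathlib

open Filter Topology CategoryTheory

noncomputable section

universe u v

namespace Berkovich

/-! ### The Banach algebra `k{r⁻¹T}` -/

section TateAlgebra

variable (k : Type u) [NormedField k] [IsUltrametricDist k] {n : ℕ}
  (r : Fin n → {x : ℝ // 0 < x})

/-- The algebra `k{r₁⁻¹T₁, …, rₙ⁻¹Tₙ}` of the power series `∑ a_I T^I` over `k` such that
`|a_I| r^I` tends to `0` as `|I|` tends to infinity. -/
def TateAlgebra : Subalgebra k (MvPowerSeries (Fin n) k) where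
  __ := MvPowerSeries.IsRestricted.subring (fun i => (r i : ℝ))
  algebraMap_mem' a := MvPowerSeries.isRestricted_C _ a

namespace TateAlgebra

variable {k r}

theorem isRestricted (f : TateAlgebra k r) :
    MvPowerSeries.IsRestricted (fun i => (r i : ℝ)) (f : MvPowerSeries (Fin n) k) := f.2

theorem weight_pos (t : Fin n →₀ ℕ) : 0 < t.prod (fun i m => (r i : ℝ) ^ m) :=
  Finset.prod_pos fun i _ => pow_pos (r i).2 _

theorem hasGaussNorm (f : TateAlgebra k r) :
    MvPowerSeries.HasGaussNorm (fun a : k => ‖a‖) (fun i => (r i : ℝ))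
      (f : MvPowerSeries (Fin n) k) :=
  (isRestricted f).bddAbove_range_of_cofinite

theorem isNonarchimedean_norm : IsNonarchimedean (fun a : k => ‖a‖) :=
  fun a b => IsUltrametricDist.norm_add_le_max a b

/-- The Gauss norm `‖∑ a_I T^I‖ = sup_I |a_I| r^I`. -/
instance : Norm (TateAlgebra k r) where
  norm f := MvPowerSeries.gaussNorm (fun a : k => ‖a‖) (fun i => (r i : ℝ))
    (f : MvPowerSeries (Fin n) k)

theorem norm_def (f : TateAlgebra k r) :
    ‖f‖ = MvPowerSeries.gaussNorm (fun a : k => ‖a‖) (fun i => (r i : ℝ))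
      (f : MvPowerSeries (Fin n) k) := rfl

theorem coeff_le (f : TateAlgebra k r) (t : Fin n →₀ ℕ) :
    ‖MvPowerSeries.coeff t (f : MvPowerSeries (Fin n) k)‖ * t.prod (fun i m => (r i : ℝ) ^ m)
      ≤ ‖f‖ :=
  MvPowerSeries.le_gaussNorm _ _ _ (hasGaussNorm f) t

theorem norm_le_of_coeff (f : TateAlgebra k r) {C : ℝ}
    (h : ∀ t, ‖MvPowerSeries.coeff t (f : MvPowerSeries (Fin n) k)‖ *
      t.prod (fun i m => (r i : ℝ) ^ m) ≤ C) : ‖f‖ ≤ C :=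
  ciSup_le h

theorem weight_nonneg : (0 : Fin n → ℝ) ≤ fun i => (r i : ℝ) := fun i => (r i).2.le

theorem norm_add_le_max' (f g : TateAlgebra k r) : ‖f + g‖ ≤ max ‖f‖ ‖g‖ :=
  MvPowerSeries.gaussNorm_add_le_max _ _ _ _ weight_nonneg (fun _ => norm_nonneg _)
    isNonarchimedean_norm (hasGaussNorm f) (hasGaussNorm g)

theorem norm_nonneg' (f : TateAlgebra k r) : 0 ≤ ‖f‖ :=
  MvPowerSeries.gaussNorm_nonneg _ _ _ (fun _ => norm_nonneg _)

theorem norm_neg' (f : TateAlgebra k r) : ‖-f‖ = ‖f‖ :=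
  MvPowerSeries.gaussNorm_neg _ _ (fun a => norm_neg a) _

theorem norm_mul_le' (f g : TateAlgebra k r) : ‖f * g‖ ≤ ‖f‖ * ‖g‖ :=
  MvPowerSeries.gaussNorm_mul_le _ _ _ _ weight_nonneg (fun _ => norm_nonneg _)
    (fun a b => norm_mul_le a b) isNonarchimedean_norm norm_zero
    (hasGaussNorm f) (hasGaussNorm g)

theorem norm_eq_zero' (f : TateAlgebra k r) : ‖f‖ = 0 ↔ f = 0 := by
  rw [norm_def, MvPowerSeries.gaussNorm_eq_zero_iff _ _ _ norm_zero (fun _ => norm_nonneg _)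
    (fun x hx => norm_eq_zero.1 hx) (fun i => (r i).2) (hasGaussNorm f)]
  exact ZeroMemClass.coe_eq_zero

theorem norm_smul' (a : k) (f : TateAlgebra k r) : ‖a • f‖ ≤ ‖a‖ * ‖f‖ := by
  refine norm_le_of_coeff _ fun t => ?_
  have h := coeff_le f t
  calc _ = ‖a‖ * (‖MvPowerSeries.coeff t (f : MvPowerSeries (Fin n) k)‖ *
        t.prod (fun i m => (r i : ℝ) ^ m)) := by simp [mul_assoc]
    _ ≤ _ := by gcongr

instance : NormedCommRing (TateAlgebra k r) where
  __ := (inferInstance : CommRing (TateAlgebra k r))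
  __ := NormedAddCommGroup.ofCore (𝕜 := k) (E := TateAlgebra k r)
    { norm_nonneg := norm_nonneg'
      norm_smul := fun a f => by
        refine le_antisymm (norm_smul' a f) ?_
        rcases eq_or_ne a 0 with rfl | ha
        · simpa using norm_nonneg' _
        · have h := norm_smul' a⁻¹ (a • f)
          rw [inv_smul_smul₀ ha, norm_inv] at h
          rwa [inv_mul_eq_div, le_div_iff₀' (norm_pos_iff.2 ha)] at h
      norm_triangle := fun f g => (norm_add_le_max' f g).trans
        (max_le_add_of_nonneg (norm_nonneg' f) (norm_nonneg' g))
      norm_eq_zero_iff := norm_eq_zero' }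
  norm_mul_le := norm_mul_le'

instance : NormedAlgebra k (TateAlgebra k r) where
  norm_smul_le := norm_smul'

instance : IsUltrametricDist (TateAlgebra k r) :=
  IsUltrametricDist.isUltrametricDist_of_forall_norm_add_le_max_norm norm_add_le_max'

instance [CompleteSpace k] : CompleteSpace (TateAlgebra k r) := by
  refine Metric.complete_of_cauchySeq_tendsto fun F hF => ?_
  have key (t : Fin n →₀ ℕ) : CauchySeq fun m =>
      MvPowerSeries.coeff t (F m : MvPowerSeries (Fin n) k) := by
    rw [Metric.cauchySeq_iff] at hF ⊢
    intro ε hε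
    obtain ⟨N, hN⟩ := hF (ε * t.prod (fun i m => (r i : ℝ) ^ m)) (mul_pos hε (weight_pos t))
    refine ⟨N, fun a ha b hb => ?_⟩
    have h1 := hN a ha b hb
    have h2 := coeff_le (F a - F b) t
    rw [dist_eq_norm] at h1 ⊢
    have h3 := h2.trans_lt h1
    simpa using lt_of_mul_lt_mul_right h3 (weight_pos t).le
  choose c hc using fun t => cauchySeq_tendsto_of_complete (key t)
  let g : MvPowerSeries (Fin n) k := c
  have hg (t) : MvPowerSeries.coeff t g = c t := rfl
  have close (ε : ℝ) (hε : 0 < ε) : ∃ N, ∀ m ≥ N, ∀ t,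
      ‖MvPowerSeries.coeff t (F m : MvPowerSeries (Fin n) k) - c t‖ *
        t.prod (fun i m => (r i : ℝ) ^ m) ≤ ε := by
    obtain ⟨N, hN⟩ := Metric.cauchySeq_iff.1 hF ε hε
    refine ⟨N, fun m hm t => ?_⟩
    have hlim := ((tendsto_const_nhds (x :=
      MvPowerSeries.coeff t (F m : MvPowerSeries (Fin n) k))).sub (hc t)).norm.mul_const
        (t.prod (fun i m => (r i : ℝ) ^ m))
    refine le_of_tendsto hlim (eventually_atTop.2 ⟨N, fun b hb => ?_⟩)
    have h1 := hN m hm b hb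
    rw [dist_eq_norm] at h1
    have h2 := (coeff_le (F m - F b) t).trans h1.le
    simpa using h2
  have hgr : MvPowerSeries.IsRestricted (fun i => (r i : ℝ)) g := by
    rw [MvPowerSeries.IsRestricted, Metric.tendsto_nhds]
    intro ε hε
    obtain ⟨N, hN⟩ := close (ε / 2) (half_pos hε)
    filter_upwards [Metric.tendsto_nhds.1 (isRestricted (F N)) ε hε] with t ht
    have h1 := hN N le_rfl t
    have hw := weight_pos (r := r) t
    rw [Real.dist_0_eq_abs, abs_of_nonneg (by positivity)] at ht ⊢
    have h2 : ‖c t‖ ≤ max ‖MvPowerSeries.coeff t (F N : MvPowerSeries (Fin n) k)‖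
        ‖MvPowerSeries.coeff t (F N : MvPowerSeries (Fin n) k) - c t‖ := by
      have := IsUltrametricDist.norm_add_le_max
        (MvPowerSeries.coeff t (F N : MvPowerSeries (Fin n) k))
        (-(MvPowerSeries.coeff t (F N : MvPowerSeries (Fin n) k) - c t))
      rw [norm_neg] at this
      simpa using this
    rw [hg]
    rcases le_max_iff.1 h2 with h | h
    · exact (mul_le_mul_of_nonneg_right h hw.le).trans_lt ht
    · exact ((mul_le_mul_of_nonneg_right h hw.le).trans h1).trans_lt (half_lt_self hε)
  refine ⟨⟨g, hgr⟩, Metric.tendsto_atTop.2 fun ε hε => ?_⟩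
  obtain ⟨N, hN⟩ := close (ε / 2) (half_pos hε)
  refine ⟨N, fun m hm => ?_⟩
  rw [dist_eq_norm]
  refine lt_of_le_of_lt (norm_le_of_coeff _ fun t => ?_) (half_lt_self hε)
  simpa [hg] using hN m hm t

end TateAlgebra

end TateAlgebra

/-! ### Affinoid algebras and affinoid spaces -/

/-- A Banach `k`-algebra `A` is `k`-affinoid if there is an admissible epimorphism
`φ : k{r⁻¹T} → A`: a bounded surjective homomorphism of `k`-algebras such that the norm of `A`
is equivalent to the residue norm (every `a` has a preimage of norm at most `C ‖a‖`). -/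
def IsAffinoidAlgebra (k : Type u) [NormedField k] [IsUltrametricDist k]
    (A : Type v) [NormedCommRing A] [NormedAlgebra k A] : Prop :=
  ∃ (m : ℕ) (r : Fin m → {x : ℝ // 0 < x}) (φ : TateAlgebra k r →ₐ[k] A) (C : ℝ),
    (∀ f, ‖φ f‖ ≤ C * ‖f‖) ∧ ∀ a : A, ∃ f, φ f = a ∧ ‖f‖ ≤ C * ‖a‖

/-- A `k`-affinoid space, given by its `k`-affinoid algebra of analytic functions. Its points are
in `AffinoidSpace.Points`. -/
structure AffinoidSpace (k : Type u) [NormedField k] [IsUltrametricDist k] where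
  /-- the algebra of analytic functions -/
  functions : Type u
  [normedCommRing : NormedCommRing functions]
  [normedAlgebra : NormedAlgebra k functions]
  [isUltrametricDist : IsUltrametricDist functions]
  [completeSpace : CompleteSpace functions]
  isAffinoidAlgebra : IsAffinoidAlgebra k functions

namespace AffinoidSpace

attribute [instance] normedCommRing normedAlgebra isUltrametricDist completeSpace

variable {k : Type u} [NormedField k] [IsUltrametricDist k]

/-- The underlying set of an affinoid space: the Berkovich spectrum of its algebra of functions,
that is, the set of bounded multiplicative seminorms `f ↦ |f(x)|`. -/
def Points (X : AffinoidSpace k) : Type u :=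
  {x : MulRingSeminorm X.functions // ∀ f, x f ≤ ‖f‖}

/-- The coarsest topology for which all maps `x ↦ |f(x)|` are continuous. -/
instance (X : AffinoidSpace k) : TopologicalSpace X.Points :=
  TopologicalSpace.induced (fun x (f : X.functions) => x.1 f) inferInstance

/-- A morphism of `k`-affinoid spaces `X → Y` is a bounded homomorphism of `k`-algebras from the
functions on `Y` to the functions on `X` (the category of `k`-affinoid spaces is dual to that of
`k`-affinoid algebras, and is a full subcategory of the category of `k`-analytic spaces). -/
@[ext]
structure Hom (X Y : AffinoidSpace k) where
  /-- the pull-back of functions -/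
  comap : Y.functions →ₐ[k] X.functions
  bounded : ∃ C : ℝ, ∀ f, ‖comap f‖ ≤ C * ‖f‖

instance : Category (AffinoidSpace k) where
  Hom := Hom
  id X := ⟨AlgHom.id k X.functions, 1, fun f => by simp⟩
  comp {X Y Z} φ ψ := ⟨φ.comap.comp ψ.comap, by
    obtain ⟨C, hC⟩ := φ.bounded
    obtain ⟨D, hD⟩ := ψ.bounded
    refine ⟨|C| * D, fun f => (hC _).trans ?_⟩
    rw [mul_assoc]
    exact mul_le_mul (le_abs_self C) (hD f) (norm_nonneg _) (abs_nonneg C)⟩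

/-- A bounded multiplicative seminorm pulled back along a morphism is bounded by the norm. -/
theorem Hom.pullback_le {X Y : AffinoidSpace k} (φ : Hom X Y) (x : X.Points)
    (f : Y.functions) : x.1 (φ.comap f) ≤ ‖f‖ := by
  obtain ⟨C, hC⟩ := φ.bounded
  refine le_of_forall_gt_imp_ge_of_dense fun b hb => ?_
  have hb0 : 0 < b := (norm_nonneg f).trans_lt hb
  by_contra! hlt
  have h1 (m : ℕ) : (x.1 (φ.comap f) / b) ^ (m + 1) ≤ C := by
    have h2 : x.1 (φ.comap f) ^ (m + 1) ≤ C * ‖f ^ (m + 1)‖ := by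
      rw [← map_pow, ← map_pow]
      exact (x.2 _).trans (hC _)
    have h3 : ‖f ^ (m + 1)‖ ≤ b ^ (m + 1) :=
      (norm_pow_le' f m.succ_pos).trans (pow_le_pow_left₀ (norm_nonneg _) hb.le _)
    have hC0 : 0 ≤ C := by
      by_contra! hC0
      have h4 := pow_pos (hb0.trans hlt) (m + 1)
      have h5 := mul_nonpos_of_nonpos_of_nonneg hC0.le (norm_nonneg (f ^ (m + 1)))
      linarith
    rw [div_pow, div_le_iff₀ (pow_pos hb0 _)]
    exact h2.trans (mul_le_mul_of_nonneg_left h3 hC0)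
  have h6 := tendsto_pow_atTop_atTop_of_one_lt ((one_lt_div hb0).2 hlt)
  obtain ⟨m, hm⟩ := ((tendsto_add_atTop_iff_nat 1).2 h6 |>.eventually_gt_atTop C).exists
  exact (h1 m).not_gt hm

/-- The map of points induced by a morphism: `|f(φ(x))| = |(φ^* f)(x)|`. -/
def Hom.onPoints {X Y : AffinoidSpace k} (φ : Hom X Y) (x : X.Points) : Y.Points :=
  ⟨{ toFun := fun f => x.1 (φ.comap f)
     map_zero' := by simp
     add_le' := fun f g => by rw [map_add]; exact map_add_le_add x.1 _ _
     neg' := fun f => by rw [map_neg]; exact map_neg_eq_map x.1 _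
     map_one' := by simp
     map_mul' := fun f g => by simp }, φ.pullback_le x⟩

theorem Hom.continuous_onPoints {X Y : AffinoidSpace k} (φ : Hom X Y) :
    Continuous φ.onPoints :=
  continuous_induced_rng.2 <| continuous_pi fun f =>
    (continuous_apply (φ.comap f)).comp continuous_induced_dom

/-- The closed polydisc `𝔻_r` over `k` centred at the origin, of polyradius `r`: the affinoid
space of `k{r⁻¹T}`, i.e. the domain `|T_i| ≤ r_i` of the analytic affine space. -/
def polydisc (k : Type u) [NormedField k] [IsUltrametricDist k] [CompleteSpace k] {n : ℕ}
    (r : Fin n → {x : ℝ // 0 < x}) : AffinoidSpace k where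
  functions := TateAlgebra k r
  isAffinoidAlgebra := ⟨n, r, AlgHom.id k _, 1, fun f => by simp, fun f => ⟨f, by simp⟩⟩

/-- `X` is a closed `k`-polydisc of type `r` if it is isomorphic to `𝔻_r`. -/
def IsClosedPolydisc [CompleteSpace k] (X : AffinoidSpace k) {n : ℕ}
    (r : Fin n → {x : ℝ // 0 < x}) : Prop :=
  Nonempty (X ≅ polydisc k r)

end AffinoidSpace

end Berkovich

end

noncomputable section

universe u v

namespace Berkovich

namespace TateAlgebra

variable {k : Type u} [NormedField k] [IsUltrametricDist k] {n : ℕ}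
  {r : Fin n → {x : ℝ // 0 < x}}

/-! ### The Gauss norm is multiplicative -/

/-! The Gauss norm is multiplicative, so it is a point of the Berkovich spectrum. Its pull-back
along any morphism is again a point, hence bounded by the norm with constant 1: bounded
homomorphisms between the algebras of polydiscs are contractions (`norm_comap_le`).

Given an isomorphism, a translation of the target polydisc makes it preserve the origin. By the
chain rule (`linCoeff_algHom`) the linear parts are mutually inverse matrices `A`, `B`, and
contractivity gives `|A i j| s_j ≤ r_i` and `|B j i| r_i ≤ s_j`. The ultrametric Leibniz formula
yields `|det A| ∏ s ≤ ∏ r` and `|det B| ∏ r ≤ ∏ s`. Since `det A * det B = 1`, both are equalities,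
and a largest term of `det A` is a permutation `σ` with `|A i (σ i)| s_{σ i} = r_i` for all `i`
(`exists_perm_norm_eq`).

Conversely, permuting and rescaling the coordinates is an isomorphism, by the universal property
`exists_lift`. -/

theorem finite_setOf_le (f : TateAlgebra k r) {ε : ℝ} (hε : 0 < ε) :
    {t : Fin n →₀ ℕ | ε ≤ ‖MvPowerSeries.coeff t (f : MvPowerSeries (Fin n) k)‖ *
      t.prod (fun i m => (r i : ℝ) ^ m)}.Finite := by
  have h := (isRestricted f).eventually (gt_mem_nhds hε)
  rw [Filter.eventually_cofinite] at h
  simpa using h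

theorem finite_achievesGaussNorm {f : TateAlgebra k r} (hf : f ≠ 0) :
    {t | MvPowerSeries.AchievesGaussNorm (fun a : k => ‖a‖) (fun i => (r i : ℝ))
      (f : MvPowerSeries (Fin n) k) t}.Finite :=
  (finite_setOf_le f (norm_pos_iff.2 hf)).subset fun _ ht => ge_of_eq ht

/-- Only finitely many terms reach half the norm, so the supremum is a maximum. -/
theorem exists_achievesGaussNorm {f : TateAlgebra k r} (hf : f ≠ 0) :
    ∃ t, MvPowerSeries.AchievesGaussNorm (fun a : k => ‖a‖) (fun i => (r i : ℝ))
      (f : MvPowerSeries (Fin n) k) t := by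
  have hpos := norm_pos_iff.2 hf
  by_contra! hne
  set F : (Fin n →₀ ℕ) → ℝ := fun t => ‖MvPowerSeries.coeff t (f : MvPowerSeries (Fin n) k)‖ *
      t.prod (fun i m => (r i : ℝ) ^ m) with hF
  have hfin := finite_setOf_le f (half_pos hpos)
  obtain ⟨C, hC, hC'⟩ : ∃ C < ‖f‖, ∀ t ∈ hfin.toFinset, F t ≤ C := by
    by_cases hs : hfin.toFinset.Nonempty
    · obtain ⟨t, ht, hmax⟩ := hfin.toFinset.exists_max_image F hs
      exact ⟨F t, lt_of_le_of_ne (coeff_le f t) (hne t), hmax⟩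
    · exact ⟨‖f‖ / 2, half_lt_self hpos, fun t ht => (hs ⟨t, ht⟩).elim⟩
  have h : ‖f‖ ≤ max C (‖f‖ / 2) := norm_le_of_coeff f fun t => by
    by_cases ht : t ∈ hfin.toFinset
    · exact (hC' t ht).trans (le_max_left _ _)
    · exact (le_of_not_ge (by simpa using ht)).trans (le_max_right _ _)
  exact absurd h (not_le.2 (max_lt hC (half_lt_self hpos)))

/-- The lexicographically largest index at which the Gauss norm is attained. -/
theorem exists_dominant {f : TateAlgebra k r} (hf : f ≠ 0) :
    ∃ t, MvPowerSeries.AchievesGaussNorm (fun a : k => ‖a‖) (fun i => (r i : ℝ))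
      (f : MvPowerSeries (Fin n) k) t ∧
      ∀ t', MvPowerSeries.AchievesGaussNorm (fun a : k => ‖a‖) (fun i => (r i : ℝ))
        (f : MvPowerSeries (Fin n) k) t' → toLex t' ≤ toLex t := by
  have hfin := finite_achievesGaussNorm hf
  obtain ⟨t₀, h₀⟩ := exists_achievesGaussNorm hf
  obtain ⟨t, ht, hmax⟩ := hfin.toFinset.exists_max_image toLex ⟨t₀, by simpa using h₀⟩
  exact ⟨t, by simpa using ht, fun t' ht' => hmax t' (by simpa using ht')⟩

theorem weight_add (p q : Fin n →₀ ℕ) :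
    (p + q).prod (fun i m => (r i : ℝ) ^ m) =
      p.prod (fun i m => (r i : ℝ) ^ m) * q.prod (fun i m => (r i : ℝ) ^ m) :=
  Finsupp.prod_add_index' (by simp) (by simp [pow_add])

/-- If `i`, `j` are the dominant indices of `f`, `g`, then the term from `(i, j)` strictly dominates
all others in the coefficient of `f * g` at `i + j`. -/
instance : NormMulClass (TateAlgebra k r) where
  norm_mul f g := by
    rcases eq_or_ne f 0 with rfl | hf
    · simp
    rcases eq_or_ne g 0 with rfl | hg
    · simp
    refine MvPowerSeries.gaussNorm_mul_eq_mul _ _ _ _ (hasGaussNorm f) (hasGaussNorm g)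
      (hasGaussNorm (f * g)) (fun _ => norm_nonneg _) norm_zero isNonarchimedean_norm
      (fun a b => norm_mul a b) (fun a => norm_neg a) (fun x hx => norm_eq_zero.1 hx)
      (fun i => (r i).2) ?_
    obtain ⟨i, hi, hi'⟩ := exists_dominant hf
    obtain ⟨j, hj, hj'⟩ := exists_dominant hg
    refine ⟨i, j, hi, hj, fun ⟨p, q⟩ hpq hne => ?_⟩
    rw [Finset.HasAntidiagonal.mem_antidiagonal] at hpq
    dsimp only at hpq ⊢
    rw [norm_mul]
    have hw := weight_add (r := r) p q
    rw [hpq, weight_add] at hw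
    -- The weight is constant along the antidiagonal, so coefficients may be compared after
    -- weighting.
    refine lt_of_mul_lt_mul_right (a := i.prod (fun i m => (r i : ℝ) ^ m) *
      j.prod (fun i m => (r i : ℝ) ^ m)) ?_ (mul_pos (weight_pos i) (weight_pos j)).le
    have hfp := coeff_le f p
    have hgq := coeff_le g q
    have hif : _ = ‖f‖ := hi
    have hjg : _ = ‖g‖ := hj
    calc _ = (‖MvPowerSeries.coeff p (f : MvPowerSeries (Fin n) k)‖ *
            p.prod (fun i m => (r i : ℝ) ^ m)) *
          (‖MvPowerSeries.coeff q (g : MvPowerSeries (Fin n) k)‖ *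
            q.prod (fun i m => (r i : ℝ) ^ m)) := by rw [hw]; ring
      _ < ‖f‖ * ‖g‖ := by
        rcases hfp.lt_or_eq with hlt | heq
        · exact (mul_le_mul_of_nonneg_left hgq
            (mul_nonneg (norm_nonneg _) (weight_pos p).le)).trans_lt
              (mul_lt_mul_of_pos_right hlt (norm_pos_iff.2 hg))
        rcases hgq.lt_or_eq with hlt | heq'
        · rw [heq]
          exact mul_lt_mul_of_pos_left hlt (norm_pos_iff.2 hf)
        -- Both norms are attained, so `p ≤ i` and `q ≤ j` lexicographically; equal sums then force
        -- `p = i`.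
        · have h1 := hi' p heq
          have h2 := hj' q heq'
          have h3 : toLex p + toLex q = toLex i + toLex j := by
            rw [← toLex_add, ← toLex_add, hpq]
          have h4 : toLex p = toLex i := by
            refine h1.antisymm (le_of_not_gt fun hlt => ?_)
            exact absurd h3 (add_lt_add_of_lt_of_le hlt h2).ne
          have h5 : p = i := toLex.injective h4
          subst h5
          exact (hne (by rw [add_left_cancel hpq])).elim
      _ = _ := by rw [← hif, ← hjg]; ring

instance : Nontrivial (TateAlgebra k r) := by
  refine ⟨0, 1, fun h => ?_⟩
  have := congrArg (fun f : TateAlgebra k r =>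
    MvPowerSeries.coeff 0 (f : MvPowerSeries (Fin n) k)) h
  simp at this

instance : NormOneClass (TateAlgebra k r) := NormMulClass.toNormOneClass

/-! ### Coordinates and polynomials -/

variable (k r) in
/-- The coordinate function `T_i`. -/
def X (i : Fin n) : TateAlgebra k r :=
  ⟨MvPowerSeries.X i, MvPowerSeries.isRestricted_monomial _ _ _⟩

@[simp]
theorem coe_X (i : Fin n) : (X k r i : MvPowerSeries (Fin n) k) = MvPowerSeries.X i := rfl

theorem norm_X_le (i : Fin n) : ‖X k r i‖ ≤ r i := by
  refine norm_le_of_coeff _ fun t => ?_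
  classical
  rw [coe_X, MvPowerSeries.coeff_X]
  split_ifs with h
  · subst h; simp
  · simpa using (r i).2.le

theorem coe_aeval_X (p : MvPolynomial (Fin n) k) :
    (MvPolynomial.aeval (X k r) p : MvPowerSeries (Fin n) k) = p := by
  induction p using MvPolynomial.induction_on with
  | C a => simp; rfl
  | add p q hp hq => simp [hp, hq]
  | mul_X p i hp => simp [hp]

theorem aeval_X_injective :
    Function.Injective (MvPolynomial.aeval (R := k) (X k r)) := fun p q h =>
  MvPolynomial.coe_injective _ _ <| by rw [← coe_aeval_X (r := r), h, coe_aeval_X]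

theorem denseRange_aeval_X : DenseRange (MvPolynomial.aeval (R := k) (X k r)) := by
  refine Metric.denseRange_iff.2 fun f ε hε => ?_
  have hfin := finite_setOf_le f (half_pos hε)
  refine ⟨∑ t ∈ hfin.toFinset, MvPolynomial.monomial t
    (MvPowerSeries.coeff t (f : MvPowerSeries (Fin n) k)), ?_⟩
  rw [dist_eq_norm]
  refine lt_of_le_of_lt (norm_le_of_coeff _ fun t => ?_) (half_lt_self hε)
  rw [AddSubgroupClass.coe_sub, coe_aeval_X, map_sub, MvPolynomial.coeff_coe,
    MvPolynomial.coeff_sum]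
  classical
  simp only [MvPolynomial.coeff_monomial, Finset.sum_ite_eq']
  split_ifs with h
  · simpa using (half_pos hε).le
  · rw [sub_zero]
    exact le_of_not_ge (by simpa using h)

/-- Continuous maps that agree on polynomials are equal. -/
theorem eq_of_eq_aeval_X {E : Type*} [TopologicalSpace E] [T2Space E]
    {φ ψ : TateAlgebra k r → E} (hφ : Continuous φ) (hψ : Continuous ψ)
    (h : ∀ p : MvPolynomial (Fin n) k, φ (MvPolynomial.aeval (X k r) p) = ψ (MvPolynomial.aeval (X k r) p)) : φ = ψ :=
  denseRange_aeval_X.equalizer hφ hψ (funext h)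

/-! ### Homomorphisms out of the Tate algebra -/

section lift

variable {B : Type*} [NormedCommRing B] [NormedAlgebra k B]

theorem algHom_ext {φ ψ : TateAlgebra k r →ₐ[k] B} (hφ : Continuous φ) (hψ : Continuous ψ)
    (h : ∀ i, φ (X k r i) = ψ (X k r i)) : φ = ψ := by
  refine DFunLike.coe_injective (eq_of_eq_aeval_X hφ hψ fun p => ?_)
  rw [← AlgHom.comp_apply, ← AlgHom.comp_apply, MvPolynomial.comp_aeval,
    MvPolynomial.comp_aeval, funext h]

variable [IsUltrametricDist B] [NormOneClass B]

theorem norm_aeval_le {b : Fin n → B} (hb : ∀ i, ‖b i‖ ≤ r i) (p : MvPolynomial (Fin n) k) :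
    ‖MvPolynomial.aeval b p‖ ≤ ‖MvPolynomial.aeval (X k r) p‖ := by
  rw [MvPolynomial.aeval_def, MvPolynomial.eval₂_eq']
  refine IsUltrametricDist.norm_sum_le_of_forall_le_of_nonneg (norm_nonneg _) fun t _ => ?_
  refine le_trans ?_ (coeff_le _ t)
  rw [coe_aeval_X, MvPolynomial.coeff_coe]
  rw [← Algebra.smul_def, Finsupp.prod_fintype _ _ (by simp)]
  refine (norm_smul_le _ _).trans (mul_le_mul_of_nonneg_left ?_ (norm_nonneg _))
  refine (Finset.norm_prod_le _ _).trans (Finset.prod_le_prod (fun _ _ => norm_nonneg _)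
    fun i _ => ?_)
  exact (norm_pow_le _ _).trans (pow_le_pow_left₀ (norm_nonneg _) (hb i) _)

/-- The universal property of `k{r⁻¹T}`. -/
theorem exists_lift [CompleteSpace B] {b : Fin n → B} (hb : ∀ i, ‖b i‖ ≤ r i) :
    ∃ φ : TateAlgebra k r →ₐ[k] B, (∀ i, φ (X k r i) = b i) ∧ ∀ f, ‖φ f‖ ≤ ‖f‖ := by
  -- Evaluation at `b` is contractive on the dense subalgebra of polynomials, so it extends by
  -- continuity.
  let e := AlgEquiv.ofInjective (MvPolynomial.aeval (R := k) (X k r)) aeval_X_injective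
  let P := (MvPolynomial.aeval (R := k) (X k r)).range
  let g : P →ₐ[k] B := (MvPolynomial.aeval b).comp e.symm.toAlgHom
  have hg (x : P) : ‖g x‖ ≤ ‖x‖ := by
    obtain ⟨p, rfl⟩ := e.surjective x
    have h1 : g (e p) = MvPolynomial.aeval b p := by simp [g]
    rw [h1]
    exact norm_aeval_le hb p
  have hgc : UniformContinuous g :=
    AddMonoidHomClass.uniformContinuous_of_bound g 1 fun x => by simpa using hg x
  have hu : IsUniformInducing P.val.toRingHom := isUniformInducing_val _
  have hd : DenseRange P.val.toRingHom := by
    have h := denseRange_aeval_X (k := k) (r := r)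
    have h2 : Set.range P.val.toRingHom = Set.range (MvPolynomial.aeval (R := k) (X k r)) :=
      Subtype.range_coe
    rwa [DenseRange, h2]
  let φ := IsDenseInducing.extendRingHom (f := g.toRingHom) hu hd hgc
  have hφc : Continuous φ := (uniformContinuous_uniformly_extend hu hd hgc).continuous
  have hφ (p : MvPolynomial (Fin n) k) : φ (MvPolynomial.aeval (X k r) p) = MvPolynomial.aeval b p := by
    have h1 : φ (P.val.toRingHom (e p)) = g (e p) :=
      IsDenseInducing.extend_eq (hu.isDenseInducing hd) hgc.continuous (e p)
    have h2 : g (e p) = MvPolynomial.aeval b p := by simp [g]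
    rw [← h2, ← h1]; rfl
  refine ⟨{ φ with commutes' := fun a => ?_ }, fun i => ?_, fun f => ?_⟩
  · have := hφ (MvPolynomial.C a)
    simpa using this
  · have := hφ (MvPolynomial.X i)
    simpa using this
  · change ‖φ f‖ ≤ ‖f‖
    refine denseRange_aeval_X.induction_on (p := fun f => ‖φ f‖ ≤ ‖f‖) f
      (isClosed_le hφc.norm continuous_norm) fun p => ?_
    rw [hφ]
    exact norm_aeval_le hb p

end lift

/-! ### Linear coefficients -/

/-- The coefficient of `T_j`. -/
def linCoeff (j : Fin n) : TateAlgebra k r →ₗ[k] k :=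
  (MvPowerSeries.coeff (Finsupp.single j 1)).comp (TateAlgebra k r).val.toLinearMap

/-- The constant coefficient. -/
def constCoeff : TateAlgebra k r →ₐ[k] k where
  toRingHom := MvPowerSeries.constantCoeff.comp (TateAlgebra k r).val.toRingHom
  commutes' a := MvPowerSeries.constantCoeff_C (σ := Fin n) a

theorem constCoeff_apply (f : TateAlgebra k r) :
    constCoeff f = MvPowerSeries.coeff 0 (f : MvPowerSeries (Fin n) k) := rfl

theorem linCoeff_apply (j : Fin n) (f : TateAlgebra k r) :
    linCoeff j f = MvPowerSeries.coeff (Finsupp.single j 1) (f : MvPowerSeries (Fin n) k) := rfl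

theorem norm_constCoeff_le (f : TateAlgebra k r) : ‖constCoeff f‖ ≤ ‖f‖ := by
  have h := coeff_le f 0
  rwa [Finsupp.prod_zero_index, mul_one] at h

theorem norm_linCoeff_mul_le (j : Fin n) (f : TateAlgebra k r) :
    ‖linCoeff j f‖ * r j ≤ ‖f‖ := by
  have h := coeff_le f (Finsupp.single j 1)
  rwa [Finsupp.prod_single_index (by simp), pow_one] at h

theorem continuous_linCoeff (j : Fin n) : Continuous (linCoeff (k := k) (r := r) j) :=
  AddMonoidHomClass.continuous_of_bound _ (r j : ℝ)⁻¹ fun f => by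
    rw [inv_mul_eq_div, le_div_iff₀ (r j).2]
    exact norm_linCoeff_mul_le j f

/-- The Leibniz rule at the origin: `single j 1` splits only as `0 + single j 1` or the reverse. -/
theorem linCoeff_mul (j : Fin n) (f g : TateAlgebra k r) :
    linCoeff j (f * g) = constCoeff f * linCoeff j g + linCoeff j f * constCoeff g := by
  classical
  simp only [linCoeff_apply, constCoeff_apply, MulMemClass.coe_mul, MvPowerSeries.coeff_mul,
    Finsupp.antidiagonal_single, Finset.sum_map]
  simp [Finset.Nat.antidiagonal_succ]

theorem linCoeff_algebraMap (j : Fin n) (a : k) :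
    linCoeff j (algebraMap k (TateAlgebra k r) a) = 0 := by
  classical
  change MvPowerSeries.coeff (Finsupp.single j 1) (MvPowerSeries.C a) = 0
  rw [MvPowerSeries.coeff_C]
  simp

theorem linCoeff_X (i j : Fin n) : linCoeff j (X k r i) = if j = i then 1 else 0 :=
  MvPowerSeries.coeff_index_single_X i j

@[simp]
theorem constCoeff_X (i : Fin n) : constCoeff (X k r i) = 0 :=
  MvPowerSeries.coeff_zero_X i

/-- The chain rule at the origin. -/
theorem linCoeff_algHom {m : ℕ} {s : Fin m → {x : ℝ // 0 < x}}
    {ψ : TateAlgebra k r →ₐ[k] TateAlgebra k s} (hψ : Continuous ψ)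
    (h0 : ∀ i, constCoeff (ψ (X k r i)) = 0) (j : Fin m) (f : TateAlgebra k r) :
    linCoeff j (ψ f) = ∑ i, linCoeff i f * linCoeff j (ψ (X k r i)) := by
  refine congrFun (eq_of_eq_aeval_X ((continuous_linCoeff j).comp hψ)
    (continuous_finsetSum _ fun i _ => (continuous_linCoeff i).mul_const _) fun p => ?_) f
  -- Fixing the origin means preserving values there, which the product rule needs below.
  have hε (p : MvPolynomial (Fin n) k) : constCoeff (ψ (MvPolynomial.aeval (X k r) p)) =
      constCoeff (MvPolynomial.aeval (X k r) p) := by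
    induction p using MvPolynomial.induction_on with
    | C a => simp
    | add p q hp hq => simp [hp, hq]
    | mul_X p i hp => simp [h0]
  dsimp only [Function.comp_apply]
  induction p using MvPolynomial.induction_on with
  | C a => simp [linCoeff_algebraMap]
  | add p q hp hq => simp [hp, hq, add_mul, Finset.sum_add_distrib]
  | mul_X p i hp => simp [linCoeff_mul, h0, hε, linCoeff_X]

end TateAlgebra

/-- If mutually inverse matrices `A`, `B` are contractions between the spaces `kⁿ` with the norms
`max |x_i| r_i` and `max |x_j| s_j`, then the polyradii agree up to a permutation and the
value group. -/
theorem exists_perm_norm_eq {k : Type*} [NormedField k] [IsUltrametricDist k] {n : ℕ}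
    {r s : Fin n → {x : ℝ // 0 < x}} {A B : Matrix (Fin n) (Fin n) k} (hAB : A * B = 1)
    (hA : ∀ i j, ‖A i j‖ * s j ≤ r i) (hB : ∀ i j, ‖B i j‖ * r j ≤ s i) :
    ∃ σ : Equiv.Perm (Fin n), ∀ i, ‖A i (σ i)‖ = (r i : ℝ) * (s (σ i) : ℝ)⁻¹ := by
  have det_le {r s : Fin n → {x : ℝ // 0 < x}} {A : Matrix (Fin n) (Fin n) k}
      (hA : ∀ i j, ‖A i j‖ * s j ≤ r i) :
      ∃ σ : Equiv.Perm (Fin n), ‖A.det‖ ≤ ∏ i, ‖A i (σ i)‖ ∧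
        ‖A.det‖ * ∏ i, (s i : ℝ) ≤ ∏ i, (r i : ℝ) := by
    -- `σ` indexes a largest term of the Leibniz expansion; the transpose makes it act on columns.
    obtain ⟨σ, -, hσ⟩ := IsUltrametricDist.exists_norm_finsetSum_le_of_nonempty
      (Finset.univ_nonempty (α := Equiv.Perm (Fin n)))
      (fun σ : Equiv.Perm (Fin n) => Equiv.Perm.sign σ • ∏ i, A.transpose (σ i) i)
    have h2 : ‖A.det‖ ≤ ∏ i, ‖A i (σ i)‖ := by
      rw [← norm_prod]
      rw [← Matrix.det_transpose, Matrix.det_apply]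
      refine hσ.trans_eq ?_
      rcases Int.units_eq_one_or (Equiv.Perm.sign σ) with h | h <;> simp [h]
    refine ⟨σ, h2, (mul_le_mul_of_nonneg_right h2 (Finset.prod_nonneg
      fun i _ => (s i).2.le)).trans ?_⟩
    rw [← Equiv.prod_comp σ (fun i => (s i : ℝ)), ← Finset.prod_mul_distrib]
    exact Finset.prod_le_prod (fun i _ => mul_nonneg (norm_nonneg _) (s _).2.le)
      fun i _ => hA i (σ i)
  obtain ⟨σ, hσ, hA'⟩ := det_le hA
  obtain ⟨-, -, hB'⟩ := det_le hB
  have hdet : ‖A.det‖ * ‖B.det‖ = 1 := by rw [← norm_mul, ← Matrix.det_mul, hAB]; simp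
  have hs : 0 < ∏ i, (s i : ℝ) := Finset.prod_pos fun i _ => (s i).2
  -- Each factor on the right is at most `r i`, so this reverse inequality leaves no room for a
  -- strict one.
  have hle : ∏ i, (r i : ℝ) ≤ ∏ i, ‖A i (σ i)‖ * s (σ i) := by
    rw [Finset.prod_mul_distrib, Equiv.prod_comp σ (fun i => (s i : ℝ))]
    calc _ = ‖A.det‖ * (‖B.det‖ * ∏ i, (r i : ℝ)) := by rw [← mul_assoc, hdet, one_mul]
      _ ≤ ‖A.det‖ * ∏ i, (s i : ℝ) := by gcongr
      _ ≤ _ := by gcongr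
  refine ⟨σ, fun i => ?_⟩
  rw [eq_mul_inv_iff_mul_eq₀ (s (σ i)).2.ne']
  refine (hA i (σ i)).eq_of_not_lt fun hlt => absurd hle (not_le.2 ?_)
  -- `Finset.prod_lt_prod` needs positive factors; a zero factor makes the product vanish.
  by_cases h0 : ∃ j, ‖A j (σ j)‖ = 0
  · obtain ⟨j, hj⟩ := h0
    rw [Finset.prod_eq_zero (Finset.mem_univ j) (by rw [hj, zero_mul])]
    exact Finset.prod_pos fun i _ => (r i).2
  · push Not at h0
    exact Finset.prod_lt_prod (fun j _ => mul_pos ((norm_nonneg _).lt_of_ne' (h0 j)) (s _).2)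
      (fun j _ => hA j (σ j)) ⟨i, Finset.mem_univ i, hlt⟩

/-! ### Isomorphisms between polydiscs -/

namespace AffinoidSpace

variable {k : Type u} [NormedField k] [IsUltrametricDist k] [CompleteSpace k] {n : ℕ}
  {r s : Fin n → {x : ℝ // 0 < x}}

variable (k r) in
/-- The Gauss point of a polydisc. -/
def gaussPoint : (polydisc k r).Points :=
  ⟨{ toFun := fun f : TateAlgebra k r => ‖f‖
     map_zero' := norm_zero
     add_le' := norm_add_le
     neg' := norm_neg
     map_one' := norm_one (α := TateAlgebra k r)
     map_mul' := fun f g => norm_mul (α := TateAlgebra k r) f g }, fun _ => le_rfl⟩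

theorem norm_comap_le (φ : polydisc k r ⟶ polydisc k s) (f : TateAlgebra k s) :
    ‖(φ.comap f : TateAlgebra k r)‖ ≤ ‖f‖ :=
  φ.pullback_le (gaussPoint k r) f

theorem exists_perm_of_iso (e : polydisc k r ≅ polydisc k s) :
    ∃ σ : Equiv.Perm (Fin n), ∀ i, ∃ a : k, a ≠ 0 ∧ ‖a‖ = (s (σ i) : ℝ) * (r i : ℝ)⁻¹ := by
  let φ : TateAlgebra k r →ₐ[k] TateAlgebra k s := e.inv.comap
  let ψ : TateAlgebra k s →ₐ[k] TateAlgebra k r := e.hom.comap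
  have hφ (f) : ‖φ f‖ ≤ ‖f‖ := norm_comap_le e.inv f
  have hψ (f) : ‖ψ f‖ ≤ ‖f‖ := norm_comap_le e.hom f
  have hψφ (f) : ψ (φ f) = f := congrArg (fun g => Hom.comap g f) e.hom_inv_id
  -- The image of the origin. It lies in the polydisc of radius `s`, so the translations `τ`, `τ'`
  -- by `±c` are defined there.
  let c (j : Fin n) : k := TateAlgebra.constCoeff (ψ (TateAlgebra.X k s j))
  have hc (j) : ‖algebraMap k (TateAlgebra k s) (c j)‖ ≤ s j := by
    rw [norm_algebraMap']
    exact (TateAlgebra.norm_constCoeff_le _).trans ((hψ _).trans (TateAlgebra.norm_X_le j))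
  obtain ⟨τ, hτX, hτ⟩ := TateAlgebra.exists_lift (k := k) (r := s)
    (b := fun j => TateAlgebra.X k s j + algebraMap k _ (c j)) fun j =>
      (IsUltrametricDist.norm_add_le_max _ _).trans (max_le (TateAlgebra.norm_X_le j) (hc j))
  obtain ⟨τ', hτX', hτ'⟩ := TateAlgebra.exists_lift (k := k) (r := s)
    (b := fun j => TateAlgebra.X k s j + -algebraMap k _ (c j)) fun j =>
      (IsUltrametricDist.norm_add_le_max _ _).trans
        (max_le (TateAlgebra.norm_X_le j) ((norm_neg _).trans_le (hc j)))
  have cont {r s : Fin n → {x : ℝ // 0 < x}} {f : TateAlgebra k r →ₐ[k] TateAlgebra k s}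
      (h : ∀ x, ‖f x‖ ≤ ‖x‖) : Continuous f :=
    AddMonoidHomClass.continuous_of_bound f 1 (by simpa using h)
  have hττ : τ'.comp τ = AlgHom.id k _ :=
    TateAlgebra.algHom_ext ((cont hτ').comp (cont hτ)) continuous_id fun j => by
      simp [hτX, hτX']
  have hττ' (f) : τ' (τ f) = f := DFunLike.congr_fun hττ f
  let A : Matrix (Fin n) (Fin n) k :=
    fun i j => TateAlgebra.linCoeff j (τ (φ (TateAlgebra.X k r i)))
  let B : Matrix (Fin n) (Fin n) k :=
    fun j i => TateAlgebra.linCoeff i (ψ (τ' (TateAlgebra.X k s j)))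
  -- The chain rule for `ψ ∘ τ'` applied to `τ (φ T_i)`; only `ψ ∘ τ'` has to be shown to fix the
  -- origin.
  have hAB : A * B = 1 := by
    ext i i'
    have h := TateAlgebra.linCoeff_algHom (ψ := ψ.comp τ') ((cont hψ).comp (cont hτ'))
      (fun j => by simp [hτX', c]) i' (τ (φ (TateAlgebra.X k r i)))
    rw [AlgHom.comp_apply, hττ', hψφ, TateAlgebra.linCoeff_X] at h
    rw [Matrix.mul_apply, Matrix.one_apply]
    simpa [eq_comm] using h.symm
  obtain ⟨σ, hσ⟩ := exists_perm_norm_eq (r := r) (s := s) hAB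
    (fun i j => (TateAlgebra.norm_linCoeff_mul_le j _).trans
      ((hτ _).trans ((hφ _).trans (TateAlgebra.norm_X_le i))))
    (fun j i => (TateAlgebra.norm_linCoeff_mul_le i _).trans
      ((hψ _).trans ((hτ' _).trans (TateAlgebra.norm_X_le j))))
  refine ⟨σ, fun i => ⟨(A i (σ i))⁻¹, ?_, ?_⟩⟩
  · rw [ne_eq, inv_eq_zero, ← norm_eq_zero, hσ]
    exact (mul_pos (r i).2 (inv_pos.2 (s (σ i)).2)).ne'
  · rw [norm_inv, hσ, mul_inv, inv_inv, mul_comm]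

/-- The maps `T_i ↦ a_i⁻¹ T_{σ i}` and `T_j ↦ a_{σ⁻¹ j} T_{σ⁻¹ j}` are mutually inverse, and the
norms of the `a_i` are what `exists_lift` requires. -/
theorem nonempty_iso_of_perm (σ : Equiv.Perm (Fin n))
    (h : ∀ i, ∃ a : k, a ≠ 0 ∧ ‖a‖ = (s (σ i) : ℝ) * (r i : ℝ)⁻¹) :
    Nonempty (polydisc k r ≅ polydisc k s) := by
  choose a ha0 ha using h
  obtain ⟨φ, hφX, hφ⟩ := TateAlgebra.exists_lift (k := k) (r := r)
    (b := fun i => (a i)⁻¹ • TateAlgebra.X k s (σ i)) fun i => by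
      rw [norm_smul, norm_inv, ha, mul_inv, inv_inv]
      refine (mul_le_mul_of_nonneg_left (TateAlgebra.norm_X_le _)
        (mul_nonneg (inv_nonneg.2 (s (σ i)).2.le) (r i).2.le)).trans_eq ?_
      field_simp [(s (σ i)).2.ne']
  obtain ⟨ψ, hψX, hψ⟩ := TateAlgebra.exists_lift (k := k) (r := s)
    (b := fun j => a (σ.symm j) • TateAlgebra.X k r (σ.symm j)) fun j => by
      rw [norm_smul, ha, σ.apply_symm_apply]
      refine (mul_le_mul_of_nonneg_left (TateAlgebra.norm_X_le _)
        (mul_nonneg (s j).2.le (inv_nonneg.2 (r (σ.symm j)).2.le))).trans_eq ?_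
      field_simp [(r (σ.symm j)).2.ne']
  have cont {r s : Fin n → {x : ℝ // 0 < x}} {f : TateAlgebra k r →ₐ[k] TateAlgebra k s}
      (h : ∀ x, ‖f x‖ ≤ ‖x‖) : Continuous f :=
    AddMonoidHomClass.continuous_of_bound f 1 (by simpa using h)
  have h1 : ψ.comp φ = AlgHom.id k _ :=
    TateAlgebra.algHom_ext ((cont hψ).comp (cont hφ)) continuous_id fun i => by
      simp [hφX, hψX, ha0]
  have h2 : φ.comp ψ = AlgHom.id k _ :=
    TateAlgebra.algHom_ext ((cont hφ).comp (cont hψ)) continuous_id fun i => by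
      simp [hφX, hψX, ha0]
  exact ⟨{ hom := ⟨ψ, 1, fun f => (hψ f).trans_eq (one_mul _).symm⟩
           inv := ⟨φ, 1, fun f => (hφ f).trans_eq (one_mul _).symm⟩
           hom_inv_id := Hom.ext h1
           inv_hom_id := Hom.ext h2 }⟩

end AffinoidSpace

end Berkovich

end

theorem mainTheorem7 {k : Type*} [NormedField k] [IsUltrametricDist k] [CompleteSpace k]
    {n : ℕ} (r s : Fin n → {x : ℝ // 0 < x}) (X Y : Berkovich.AffinoidSpace k)
    (hX : X.IsClosedPolydisc r) (hY : Y.IsClosedPolydisc s) :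
    Nonempty (X ≅ Y) ↔
      ∃ σ : Equiv.Perm (Fin n), ∀ i, ∃ a : k, a ≠ 0 ∧ ‖a‖ = (s (σ i) : ℝ) * (r i : ℝ)⁻¹ := by
  obtain ⟨eX⟩ := hX
  obtain ⟨eY⟩ := hY
  refine ⟨fun ⟨e⟩ => Berkovich.AffinoidSpace.exists_perm_of_iso (eX.symm ≪≫ e ≪≫ eY), ?_⟩
  rintro ⟨σ, h⟩
  obtain ⟨e⟩ := Berkovich.AffinoidSpace.nonempty_iso_of_perm σ h
  exact ⟨eX ≪≫ e ≪≫ eY.symm⟩
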